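/- Let $r$ be a prime, let $p\neq r$ be an odd prime, and let $\alpha$ be a primitive $p$-th root of unity in an extension of $\mathbb F_{r^2}$. Let $Q$ be the set of nonzero squares modulo $p$ and $N=\mathbb F_p^\ast\setminus Q$. Let $Q_{r^2,p}$ be the quadratic residue code of length $p$ over $\mathbb F_{r^2}$, that is, the cyclic code corresponding to the ideal of $\mathbb F_{r^2}[x]/(x^p-1)$ generated by $\prod_{\ell\in Q}(x-\alpha^\ell)$. For a linear code $C\subseteq\mathbb F_{r^2}^n$, let $$\widetilde C=\Big\{(c_1,\dots,c_{n+1})\in\mathbb F_{r^2}^{n+1} : (c_1,\dots,c_n)\in C,\ \sum_{i=1}^{n+1}c_i=0\Big\}$$ be its extended code and $$C^{\perp,H}=\Big\{y\in\mathbb F_{r^2}^n : \sum_{i=1}^n x_iy_i^{\,r}=0\ \text{for all } x\in C\Big\}$$ its Hermitian dual. Write $\widetilde Q_{r^2,p+1}=\widetilde{Q_{r^2,p}}$, and let $\langle\mathbf 1_{p+1}\rangle$ be the $\mathbb F_{r^2}$-linear span of the all-one vector of length $p+1$. Then $$ \widetilde Q_{r^2,p+1}\cap\widetilde Q_{r^2,p+1}^{\perp,H}=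 \begin{cases} \{0\} & \text{if } -r\in Q \text{ and } p\not\equiv-1\pmod r,\\ \langle\mathbf 1_{p+1}\rangle & \text{if } -r\in Q \text{ and } p\equiv-1\pmod r,\\ \widetilde{Q_{r^2,p}^{\perp,H}} & \text{if } -r\in N \text{ and } p\not\equiv-1\pmod r,\\ \widetilde Q_{r^2,p+1} & \text{if } -r\in N \text{ and } p\equiv-1\pmod r. \end{cases} $$ In the last case $\widetilde Q_{r^2,p+1}$ is Hermitian self-dual, i.e. $\widetilde Q_{r^2,p+1}=\widetilde Q_{r^2,p+1}^{\perp,H}$. -/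

import Mathlib

open Polynomial

/-- The set of (nonzero) quadratic residues modulo `p`, i.e. the nonzero squares of `ZMod p`. -/
def quadResidues (p : ℕ) [Fact p.Prime] : Finset (ZMod p) :=
  (Finset.univ.filter (fun a : ZMod p => a ≠ 0)).image (fun a => a ^ 2)

/-- The set of quadratic non-residues modulo `p`. -/
def quadNonresidues (p : ℕ) [Fact p.Prime] : Finset (ZMod p) :=
  Finset.univ.filter (fun a : ZMod p => a ≠ 0 ∧ a ∉ quadResidues p)

section Codes

variable {F : Type*} [Field F]

/-- The word `(c₀, …, cₙ₋₁)` as the polynomial `∑ cᵢ xⁱ`. -/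
noncomputable def wordPoly (n : ℕ) : (Fin n → F) →ₗ[F] F[X] :=
  ∑ i : Fin n, (Polynomial.monomial (i : ℕ)).comp (LinearMap.proj i)

/-- The cyclic code of length `n` over `F` generated by `g`: the words whose class in
`F[x] / (xⁿ - 1)` lies in the ideal generated by the class of `g`. -/
noncomputable def cyclicCode (n : ℕ) (g : F[X]) : Submodule F (Fin n → F) :=
  ((Ideal.span {Ideal.Quotient.mk (Ideal.span {(X ^ n - 1 : F[X])}) g}).restrictScalars F).comap
    ((Ideal.Quotient.mkₐ F (Ideal.span {(X ^ n - 1 : F[X])})).toLinearMap.comp (wordPoly n))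

/-- The extended code; the new coordinate, labelled `∞`, is `none`. -/
def extendedCode {ι : Type*} [Fintype ι] (C : Submodule F (ι → F)) :
    Submodule F (Option ι → F) where
  carrier := {c | (fun i => c (some i)) ∈ C ∧ ∑ i, c i = 0}
  zero_mem' := ⟨C.zero_mem, by simp⟩
  add_mem' := by
    rintro a b ⟨ha, ha'⟩ ⟨hb, hb'⟩
    refine ⟨C.add_mem ha hb, ?_⟩
    simp only [Pi.add_apply, Finset.sum_add_distrib, ha', hb', add_zero]
  smul_mem' := by
    rintro t a ⟨ha, ha'⟩
    refine ⟨C.smul_mem t ha, ?_⟩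
    simp only [Pi.smul_apply, ← Finset.smul_sum, ha', smul_zero]

/-- The Hermitian inner product `∑ xᵢ yᵢ ^ r` (over a field with `r ^ 2` elements). -/
def hermInner (r : ℕ) {ι : Type*} [Fintype ι] (x y : ι → F) : F :=
  ∑ i, x i * y i ^ r

/-- The Hermitian dual `{y | (x, y)_H = 0 for all x ∈ C}`. -/
def hermitianDual (r : ℕ) [Fact r.Prime] [CharP F r] {ι : Type*} [Fintype ι]
    (C : Submodule F (ι → F)) : Submodule F (ι → F) where
  carrier := {y | ∀ x ∈ C, hermInner r x y = 0}
  zero_mem' := by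
    intro x _
    simp [hermInner, (Fact.out : r.Prime).ne_zero]
  add_mem' := by
    intro a b ha hb x hx
    have h1 := ha x hx
    have h2 := hb x hx
    simp only [hermInner] at h1 h2 ⊢
    simp only [Pi.add_apply, add_pow_char, mul_add, Finset.sum_add_distrib, h1, h2, add_zero]
  smul_mem' := by
    intro t a ha x hx
    have h1 := ha x hx
    simp only [hermInner] at h1 ⊢
    calc ∑ i, x i * (t • a) i ^ r = t ^ r * ∑ i, x i * a i ^ r := by
          rw [Finset.mul_sum]
          exact Finset.sum_congr rfl fun i _ => by
            rw [Pi.smul_apply, smul_eq_mul, mul_pow, mul_left_comm]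
      _ = 0 := by rw [h1, mul_zero]

/-- A code is Hermitian self-dual if it equals its Hermitian dual. -/
def IsHermitianSelfDual (r : ℕ) [Fact r.Prime] [CharP F r] {ι : Type*} [Fintype ι]
    (C : Submodule F (ι → F)) : Prop :=
  C = hermitianDual r C

/-- The polynomial `∏ (x - α ^ ℓ)`, the product over the quadratic residues `ℓ` modulo `p`, over
any field that contains `α`. -/
noncomputable def residuePoly {K : Type*} [Field K] (p : ℕ) [Fact p.Prime] (α : K) : K[X] :=
  ∏ ℓ ∈ quadResidues p, (X - C (α ^ ℓ.val))

variable (F) {K : Type*} [Field K] [Algebra F K]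

/-- An element of an extension of a finite field with `q` elements is in that field if it is fixed
by the `q`-th power map. -/
theorem mem_range_algebraMap_of_pow_card [Finite F] (c : K) (hc : c ^ Nat.card F = c) :
    c ∈ Set.range (algebraMap F K) := by
  classical
  have := Fintype.ofFinite F
  rw [Nat.card_eq_fintype_card] at hc
  by_contra hcon
  have hne : (X ^ Fintype.card F - X : K[X]) ≠ 0 :=
    FiniteField.X_pow_card_sub_X_ne_zero K Fintype.one_lt_card
  have hdeg := FiniteField.X_pow_card_sub_X_natDegree_eq K (p := Fintype.card F)
    Fintype.one_lt_card
  have hsub : insert c (Finset.univ.image (algebraMap F K)) ⊆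
      (X ^ Fintype.card F - X : K[X]).roots.toFinset := by
    intro x hx
    rw [Multiset.mem_toFinset, mem_roots hne]
    rcases Finset.mem_insert.1 hx with rfl | hx
    · simp [hc]
    · obtain ⟨a, -, rfl⟩ := Finset.mem_image.1 hx
      simp [← map_pow, FiniteField.pow_card]
  have h1 := Finset.card_le_card hsub
  rw [Finset.card_insert_of_notMem (by simpa using hcon),
    Finset.card_image_of_injective _ (algebraMap F K).injective, Finset.card_univ] at h1
  have h2 := Multiset.toFinset_card_le (X ^ Fintype.card F - X : K[X]).roots
  have h3 := card_roots' (X ^ Fintype.card F - X : K[X])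
  omega

/-- If `q = |F|` is a quadratic residue modulo `p`, then `residuePoly p α` has coefficients
in `F`. -/
theorem exists_map_eq_residuePoly [Finite F] (p : ℕ) [Fact p.Prime]
    (hq : (Nat.card F : ZMod p) ∈ quadResidues p) {α : K} (hα : IsPrimitiveRoot α p) :
    ∃ g : F[X], g.map (algebraMap F K) = residuePoly p α := by
  classical
  have := Fintype.ofFinite F
  suffices h : residuePoly p α ∈ lifts (algebraMap F K) by
    rw [lifts_iff_set_range] at h
    exact h
  obtain ⟨k, hk, hkq⟩ := Finset.mem_image.1 hq
  have hk0 : k ≠ 0 := by simpa using hk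
  have hfrob : (residuePoly p α).map (FiniteField.frobeniusAlgHom F K).toRingHom
      = residuePoly p α := by
    unfold residuePoly
    rw [Polynomial.map_prod]
    refine Finset.prod_bij (fun l _ => (k ^ 2) * l) ?_ ?_ ?_ ?_
    · intro l hl
      obtain ⟨a, ha, rfl⟩ := Finset.mem_image.1 hl
      have ha0 : a ≠ 0 := by simpa using ha
      exact Finset.mem_image.2 ⟨k * a, by simp [hk0, ha0], by ring⟩
    · intro a _ b _ hab
      exact mul_left_cancel₀ (pow_ne_zero 2 hk0) hab
    · intro b hb
      obtain ⟨a, ha, rfl⟩ := Finset.mem_image.1 hb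
      have ha0 : a ≠ 0 := by simpa using ha
      refine ⟨(k⁻¹ * a) ^ 2, Finset.mem_image.2 ⟨k⁻¹ * a, by simp [hk0, ha0], rfl⟩, ?_⟩
      field_simp
    · intro l _
      have : (α ^ l.val) ^ Fintype.card F = α ^ (k ^ 2 * l).val := by
        have hmod : l.val * Fintype.card F ≡ (k ^ 2 * l).val [MOD p] := by
          rw [← ZMod.natCast_eq_natCast_iff]
          rw [Nat.card_eq_fintype_card] at hkq
          simp only [Nat.cast_mul, ZMod.natCast_val, ZMod.cast_id', id_eq]
          rw [← hkq]
          ring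
        rw [← pow_mul, pow_eq_pow_mod _ hα.pow_eq_one, hmod, ← pow_eq_pow_mod _ hα.pow_eq_one]
      simp only [Polynomial.map_sub, map_X, map_C]
      congr 2
  rw [lifts_iff_coeff_lifts]
  intro n
  apply mem_range_algebraMap_of_pow_card F
  have h := congrArg (fun P => P.coeff n) hfrob
  simpa [FiniteField.coe_frobeniusAlgHom, coeff_map, Nat.card_eq_fintype_card] using h

open Classical in
/-- `∏ (x - α ^ ℓ)`, over the quadratic residues `ℓ` modulo `p`, as a polynomial over `F`
(with the irrelevant value `0` if its coefficients are not in `F`). -/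
noncomputable def qrGenerator (p : ℕ) [Fact p.Prime] (α : K) : F[X] :=
  if h : ∃ g : F[X], g.map (algebraMap F K) = residuePoly p α then h.choose else 0

/-- The generator polynomial is indeed `∏ (x - α ^ ℓ)`, whenever `|F|` is a quadratic residue
modulo `p`. -/
theorem map_qrGenerator [Finite F] (p : ℕ) [Fact p.Prime]
    (hq : (Nat.card F : ZMod p) ∈ quadResidues p) {α : K} (hα : IsPrimitiveRoot α p) :
    (qrGenerator F p α).map (algebraMap F K) = residuePoly p α := by
  have h := exists_map_eq_residuePoly F p hq hα
  rw [qrGenerator, dif_pos h]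
  exact h.choose_spec

/-- The quadratic residue code of length `p` over `F`, with respect to a primitive `p`-th root of
unity `α` in an extension of `F`. -/
noncomputable def qrCode (p : ℕ) [Fact p.Prime] (α : K) : Submodule F (Fin p → F) :=
  cyclicCode p (qrGenerator F p α)

end Codes

/-! Put x̂(j) = ∑ xᵢ α^(ij). The code consists of the words with x̂ = 0 on Q (`mem_qrCode_iff`). As
y ↦ y^r is additive, Parseval reads p·(x, y)_H = ∑ₖ x̂(-rk) ŷ(k)^r
(`mul_hermInner_eq_sum_wordTransform`). The coordinate at ∞ is -x̂(0), so extending the words only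
turns the term at k = 0 into (p + 1)·x∞·y∞^r.

The zero-sum codewords have enough freedom on N that a word orthogonal to all of them satisfies ŷ(k)
= 0 whenever -rk ∈ N (`wordTransform_eq_zero_of_forall_hermInner`). If -r ∈ Q, this kills ŷ on N;
membership in the code kills it on Q, so only constants remain. If -r ∈ N, the condition is exactly
ŷ = 0 on Q, so duality forces membership in the code, and conversely two codewords pair only through
frequency 0. Testing against constants gives (p + 1)·y∞ = 0 on the hull, whence the split according
to p ≡ -1 mod r. -/

/-! ### Residues via the quadratic character. -/

theorem mem_quadResidues_iff {p : ℕ} [Fact p.Prime] {a : ZMod p} :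
    a ∈ quadResidues p ↔ quadraticChar (ZMod p) a = 1 := by
  constructor
  · intro h
    obtain ⟨b, hb, rfl⟩ := Finset.mem_image.1 h
    exact quadraticChar_sq_one' (by simpa using hb)
  · intro h
    have ha : a ≠ 0 := by
      rintro rfl
      simp at h
    obtain ⟨b, rfl⟩ := (quadraticChar_one_iff_isSquare ha).1 h
    refine Finset.mem_image.2 ⟨b, ?_, by ring⟩
    simpa using ha

theorem mem_quadNonresidues_iff {p : ℕ} [Fact p.Prime] {a : ZMod p} :
    a ∈ quadNonresidues p ↔ quadraticChar (ZMod p) a = -1 := by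
  simp only [quadNonresidues, Finset.mem_filter, Finset.mem_univ, true_and, mem_quadResidues_iff]
  constructor
  · rintro ⟨h0, h1⟩
    exact (quadraticChar_dichotomy h0).resolve_left h1
  · intro h
    refine ⟨?_, ?_⟩
    · rintro rfl
      simp at h
    · rw [h]
      decide

theorem mem_quadResidues_or_mem_quadNonresidues {p : ℕ} [Fact p.Prime] {a : ZMod p} (ha : a ≠ 0) :
    a ∈ quadResidues p ∨ a ∈ quadNonresidues p := by
  rw [mem_quadResidues_iff, mem_quadNonresidues_iff]
  exact quadraticChar_dichotomy ha

theorem notMem_quadResidues {p : ℕ} [Fact p.Prime] {a : ZMod p} (ha : a ∈ quadNonresidues p) :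
    a ∉ quadResidues p := by
  rw [mem_quadNonresidues_iff] at ha
  rw [mem_quadResidues_iff, ha]
  decide

theorem ne_zero_of_mem_quadNonresidues {p : ℕ} [Fact p.Prime] {a : ZMod p}
    (ha : a ∈ quadNonresidues p) : a ≠ 0 := by
  rintro rfl
  simp [mem_quadNonresidues_iff] at ha

theorem zero_notMem_quadResidues {p : ℕ} [Fact p.Prime] : (0 : ZMod p) ∉ quadResidues p := by
  simp [mem_quadResidues_iff]

theorem sum_fin_natCast {M : Type*} [AddCommMonoid M] {p : ℕ} [NeZero p] (f : ZMod p → M) :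
    ∑ i : Fin p, f ((i : ℕ) : ZMod p) = ∑ a, f a := by
  refine Fintype.sum_bijective (fun i : Fin p => ((i : ℕ) : ZMod p)) ?_ _ _ fun _ => rfl
  refine (Fintype.bijective_iff_injective_and_card _).2 ⟨fun i j hij => ?_, by simp [ZMod.card]⟩
  have h := (ZMod.natCast_eq_natCast_iff' _ _ _).1 hij
  rw [Nat.mod_eq_of_lt i.2, Nat.mod_eq_of_lt j.2] at h
  exact Fin.ext h

/-! ### Finite Fourier transform and Parseval for the Hermitian form. -/

section Fourier

variable {F K : Type*} [Field F] [Field K] [Algebra F K] {p : ℕ}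

/-- The finite Fourier transform of a word with respect to an additive character. -/
def wordTransform (ψ : AddChar (ZMod p) K) (c : Fin p → F) (j : ZMod p) : K :=
  ∑ i : Fin p, algebraMap F K (c i) * ψ ((i : ℕ) * j)

theorem wordTransform_zero_right (ψ : AddChar (ZMod p) K) (c : Fin p → F) :
    wordTransform ψ c 0 = algebraMap F K (∑ i, c i) := by
  simp [wordTransform]

variable [Fact p.Prime]

theorem AddChar.IsPrimitive.sum_fin_mul {ψ : AddChar (ZMod p) K} (hψ : ψ.IsPrimitive)
    (b : ZMod p) : ∑ i : Fin p, ψ ((i : ℕ) * b) = if b = 0 then (p : K) else 0 := by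
  rw [sum_fin_natCast (fun a => ψ (a * b)), AddChar.sum_mulShift b hψ, ZMod.card]
  split_ifs <;> simp

/-- Fourier inversion recovers each coordinate up to the factor p, which is invertible in `K`. -/
theorem wordTransform_injective (hp : (p : K) ≠ 0) {ψ : AddChar (ZMod p) K} (hψ : ψ.IsPrimitive)
    {c d : Fin p → F} (h : ∀ j, wordTransform ψ c j = wordTransform ψ d j) : c = d := by
  have key : ∀ (c : Fin p → F) (m : Fin p),
      ∑ j : ZMod p, wordTransform ψ c j * ψ (-((m : ℕ) * j)) = algebraMap F K (c m) * p := by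
    intro c m
    simp only [wordTransform, Finset.sum_mul]
    rw [Finset.sum_comm, Finset.sum_eq_single m]
    · have : ∀ j : ZMod p, algebraMap F K (c m) * ψ ((m : ℕ) * j) * ψ (-((m : ℕ) * j)) =
          algebraMap F K (c m) := fun j => by
        rw [mul_assoc, ← AddChar.map_add_eq_mul]
        simp
      simp only [this, Finset.sum_const, Finset.card_univ, ZMod.card, nsmul_eq_mul]
      exact mul_comm _ _
    · intro i _ him
      have hne : (((i : ℕ) : ZMod p) - ((m : ℕ) : ZMod p)) ≠ 0 := by
        intro h0
        have h := (ZMod.natCast_eq_natCast_iff' _ _ _).1 (sub_eq_zero.1 h0)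
        rw [Nat.mod_eq_of_lt i.2, Nat.mod_eq_of_lt m.2] at h
        exact him (Fin.ext h)
      have : ∀ j : ZMod p, algebraMap F K (c i) * ψ ((i : ℕ) * j) * ψ (-((m : ℕ) * j)) =
          algebraMap F K (c i) * ψ (j * (((i : ℕ) : ZMod p) - ((m : ℕ) : ZMod p))) := fun j => by
        rw [mul_assoc, ← AddChar.map_add_eq_mul]
        congr 2
        ring
      simp only [this, ← Finset.mul_sum, AddChar.sum_mulShift _ hψ, if_neg hne, Nat.cast_zero,
        mul_zero]
    · simp
  funext m
  have h1 := key c m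
  simp only [h, key d m] at h1
  exact ((algebraMap F K).injective (mul_right_cancel₀ hp h1)).symm

/-- Parseval: the r-th power passes inside the transform and multiplies its frequency by r, so the
twist by -r leaves only the diagonal terms after orthogonality. -/
theorem mul_hermInner_eq_sum_wordTransform (r : ℕ) [Fact r.Prime] [CharP K r]
    (hr : (r : ZMod p) ≠ 0) {ψ : AddChar (ZMod p) K} (hψ : ψ.IsPrimitive) (x y : Fin p → F) :
    p * algebraMap F K (hermInner r x y) =
      ∑ k : ZMod p, wordTransform ψ x (-r * k) * wordTransform ψ y k ^ r := by
  have hpow : ∀ k, wordTransform ψ y k ^ r =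
      ∑ i : Fin p, algebraMap F K (y i) ^ r * ψ (r * ((i : ℕ) * k)) := by
    intro k
    simp only [wordTransform, sum_pow_char, mul_pow]
    refine Finset.sum_congr rfl fun i _ => ?_
    rw [← AddChar.map_nsmul_eq_pow, nsmul_eq_mul]
  simp only [hpow]
  simp only [wordTransform, Finset.sum_mul_sum]
  rw [Finset.sum_comm, hermInner, map_sum, Finset.mul_sum]
  refine Finset.sum_congr rfl fun i _ => ?_
  rw [Finset.sum_comm, Finset.sum_eq_single i]
  · have : ∀ k : ZMod p, algebraMap F K (x i) * ψ ((i : ℕ) * (-r * k)) *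
        (algebraMap F K (y i) ^ r * ψ (r * ((i : ℕ) * k))) =
        algebraMap F K (x i) * algebraMap F K (y i) ^ r := fun k => by
      rw [mul_mul_mul_comm, ← AddChar.map_add_eq_mul,
        show ((i : ℕ) : ZMod p) * (-r * k) + r * ((i : ℕ) * k) = 0 by ring, AddChar.map_zero_eq_one,
        mul_one]
    simp only [this, Finset.sum_const, Finset.card_univ, ZMod.card, nsmul_eq_mul, map_mul, map_pow]
  · intro m _ hmi
    have hne : (r : ZMod p) * (((m : ℕ) : ZMod p) - ((i : ℕ) : ZMod p)) ≠ 0 := by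
      intro h0
      have h := (ZMod.natCast_eq_natCast_iff' _ _ _).1
        (sub_eq_zero.1 ((mul_eq_zero.1 h0).resolve_left hr))
      rw [Nat.mod_eq_of_lt i.2, Nat.mod_eq_of_lt m.2] at h
      exact hmi (Fin.ext h)
    have : ∀ k : ZMod p, algebraMap F K (x i) * ψ ((i : ℕ) * (-r * k)) *
        (algebraMap F K (y m) ^ r * ψ (r * ((m : ℕ) * k))) =
        algebraMap F K (x i) * algebraMap F K (y m) ^ r *
          ψ (k * (r * (((m : ℕ) : ZMod p) - ((i : ℕ) : ZMod p)))) := fun k => by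
      rw [mul_mul_mul_comm, ← AddChar.map_add_eq_mul]
      congr 2
      ring
    simp only [this, ← Finset.mul_sum, AddChar.sum_mulShift _ hψ, if_neg hne, Nat.cast_zero,
      mul_zero]
  · simp

/-- A set of frequencies stable under multiplication by `|F|` supports words over `F` whose
transform is any prescribed character on it. -/
theorem exists_wordTransform_eq (r : ℕ) [Fact r.Prime] [CharP K r]
    [Finite F] {m : ℕ} (hF : Nat.card F = r ^ m) (hr : (r : ZMod p) ≠ 0)
    {ψ : AddChar (ZMod p) K} (hψ : ψ.IsPrimitive) (T : Finset (ZMod p))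
    (hT : ∀ k, (r : ZMod p) ^ m * k ∈ T ↔ k ∈ T) (s : ZMod p) :
    ∃ e : Fin p → F, ∀ j, wordTransform ψ e j = if j ∈ T then p * ψ (s * j) else 0 := by
  -- The witness is the inverse transform of the prescribed values. It lies in `F` because the
  -- |F|-th power merely permutes the frequencies in `T`.
  have hrange : ∀ i : Fin p, ∃ a : F,
      algebraMap F K a = ∑ n ∈ T, ψ ((s - (i : ℕ)) * n) := by
    intro i
    refine mem_range_algebraMap_of_pow_card F _ ?_
    rw [hF, sum_pow_char_pow]
    refine Finset.sum_bij (fun n _ => (r : ZMod p) ^ m * n) (fun n hn => (hT n).2 hn)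
      (fun a _ b _ h => mul_left_cancel₀ (pow_ne_zero m hr) h) (fun b hb => ?_) (fun n _ => ?_)
    · refine ⟨((r : ZMod p) ^ m)⁻¹ * b, (hT _).1 ?_, ?_⟩ <;>
        simp only [mul_inv_cancel_left₀ (pow_ne_zero m hr), hb]
    · rw [← AddChar.map_nsmul_eq_pow, nsmul_eq_mul]
      congr 1
      push_cast
      ring
  choose e he using hrange
  refine ⟨e, fun j => ?_⟩
  have h1 : wordTransform ψ e j =
      ∑ n ∈ T, ψ (s * n) * ∑ i : Fin p, ψ ((i : ℕ) * (j - n)) := by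
    simp only [wordTransform, he, Finset.sum_mul, Finset.mul_sum]
    rw [Finset.sum_comm]
    refine Finset.sum_congr rfl fun n _ => Finset.sum_congr rfl fun i _ => ?_
    rw [← AddChar.map_add_eq_mul, ← AddChar.map_add_eq_mul]
    congr 1
    ring
  simp only [h1, hψ.sum_fin_mul, sub_eq_zero, mul_ite, mul_zero, Finset.sum_ite_eq,
    mul_comm (p : K)]

/-- A word orthogonal to all shifts of a word supported on the frequencies in `T` has no
frequencies `k` with `-r * k ∈ T`. -/
theorem wordTransform_eq_zero_of_hermInner (r : ℕ) [Fact r.Prime] [CharP K r]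
    (hr : (r : ZMod p) ≠ 0) (hp : (p : K) ≠ 0) {ψ : AddChar (ZMod p) K} (hψ : ψ.IsPrimitive)
    (T : Finset (ZMod p)) (e : ZMod p → Fin p → F)
    (he : ∀ s j, wordTransform ψ (e s) j = if j ∈ T then p * ψ (s * j) else 0)
    (y : Fin p → F) (hy : ∀ s, hermInner r (e s) y = 0) {k : ZMod p} (hk : -(r : ZMod p) * k ∈ T) :
    wordTransform ψ y k = 0 := by
  have h1 : ∀ s : ZMod p, ∑ l : ZMod p, (if -(r : ZMod p) * l ∈ T then ψ (s * (-r * l)) else 0) *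
      wordTransform ψ y l ^ r = 0 := by
    intro s
    have h := mul_hermInner_eq_sum_wordTransform r hr hψ (e s) y
    rw [hy, map_zero, mul_zero] at h
    refine (mul_eq_zero.1 (?_ : (p : K) * _ = 0)).resolve_left hp
    refine Eq.trans ?_ h.symm
    rw [Finset.mul_sum]
    refine Finset.sum_congr rfl fun l _ => ?_
    rw [he]
    split_ifs <;> ring
  -- Inverting the transform in the shift `s` isolates the term `l = k`.
  have h2 : ∑ s : ZMod p, ψ (s * (r * k)) * ∑ l : ZMod p,
      (if -(r : ZMod p) * l ∈ T then ψ (s * (-r * l)) else 0) * wordTransform ψ y l ^ r = 0 :=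
    Finset.sum_eq_zero fun s _ => by rw [h1, mul_zero]
  simp only [Finset.mul_sum] at h2
  rw [Finset.sum_comm, Finset.sum_eq_single k] at h2
  · have : ∀ s : ZMod p, ψ (s * (r * k)) * ((if -(r : ZMod p) * k ∈ T then ψ (s * (-r * k)) else 0) *
        wordTransform ψ y k ^ r) = wordTransform ψ y k ^ r := fun s => by
      rw [if_pos hk, ← mul_assoc, ← AddChar.map_add_eq_mul,
        show s * (r * k) + s * (-r * k) = 0 by ring, AddChar.map_zero_eq_one, one_mul]
    simp only [this, Finset.sum_const, Finset.card_univ, ZMod.card, nsmul_eq_mul] at h2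
    exact eq_zero_of_pow_eq_zero ((mul_eq_zero.1 h2).resolve_left hp)
  · intro l _ hlk
    by_cases hl : -(r : ZMod p) * l ∈ T
    · have : ∀ s : ZMod p, ψ (s * (r * k)) * ((if -(r : ZMod p) * l ∈ T then ψ (s * (-r * l)) else 0)
          * wordTransform ψ y l ^ r) = ψ (s * (r * (k - l))) * wordTransform ψ y l ^ r := fun s => by
        rw [if_pos hl, ← mul_assoc, ← AddChar.map_add_eq_mul]
        congr 2
        ring
      simp only [this, ← Finset.sum_mul, AddChar.sum_mulShift _ hψ,
        if_neg (mul_ne_zero hr (sub_ne_zero.2 (Ne.symm hlk))), Nat.cast_zero, zero_mul]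
    · simp only [if_neg hl, zero_mul, mul_zero, Finset.sum_const_zero]
  · simp

end Fourier

/-! ### Codewords as words with prescribed zero frequencies. -/

section Membership

variable {F K : Type*} [Field F] [Field K] [Algebra F K] {p : ℕ} [Fact p.Prime]

theorem mem_cyclicCode_iff_of_dvd {n : ℕ} {g : F[X]} (hg : g ∣ X ^ n - 1) (c : Fin n → F) :
    c ∈ cyclicCode n g ↔ g ∣ wordPoly n c := by
  have h : c ∈ cyclicCode n g ↔ Ideal.Quotient.mk (Ideal.span {(X ^ n - 1 : F[X])}) (wordPoly n c) ∈
      Ideal.map (Ideal.Quotient.mk (Ideal.span {(X ^ n - 1 : F[X])})) (Ideal.span {g}) := by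
    rw [Ideal.map_span, Set.image_singleton]
    rfl
  rw [h, Ideal.mem_quotient_iff_mem (Ideal.span_singleton_le_span_singleton.2 hg),
    Ideal.mem_span_singleton]

theorem residuePoly_dvd_iff {α : K} (hα : IsPrimitiveRoot α p) (f : K[X]) :
    residuePoly p α ∣ f ↔ ∀ l ∈ quadResidues p, f.eval (α ^ l.val) = 0 := by
  constructor
  · intro h l hl
    exact dvd_iff_isRoot.1 ((Finset.dvd_prod_of_mem (fun l : ZMod p => X - C (α ^ l.val)) hl).trans h)
  · intro h
    refine Finset.prod_dvd_of_coprime ?_ fun l hl => dvd_iff_isRoot.2 (h l hl)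
    refine (pairwise_coprime_X_sub_C (s := fun l : ZMod p => α ^ l.val) ?_).set_pairwise _
    intro a b hab
    exact ZMod.val_injective p (hα.pow_inj (ZMod.val_lt a) (ZMod.val_lt b) hab)

/-- Evaluating the word polynomial at α^l gives the transform at l, and divisibility by the
generator can be tested over `K`. -/
theorem mem_qrCode_iff [Finite F] (hq : (Nat.card F : ZMod p) ∈ quadResidues p) {α : K}
    (hα : IsPrimitiveRoot α p) (c : Fin p → F) :
    c ∈ qrCode F p α ↔
      ∀ l ∈ quadResidues p, wordTransform (AddChar.zmodChar p hα.pow_eq_one) c l = 0 := by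
  have hdvd : qrGenerator F p α ∣ X ^ p - 1 := by
    rw [← map_dvd_map' (algebraMap F K), map_qrGenerator F p hq hα, residuePoly_dvd_iff hα]
    intro l _
    simp [← pow_mul, mul_comm l.val, pow_mul α p, hα.pow_eq_one]
  rw [qrCode, mem_cyclicCode_iff_of_dvd hdvd, ← map_dvd_map' (algebraMap F K),
    map_qrGenerator F p hq hα, residuePoly_dvd_iff hα]
  refine forall₂_congr fun l _ => ?_
  have : ((wordPoly p c).map (algebraMap F K)).eval (α ^ l.val) =
      wordTransform (AddChar.zmodChar p hα.pow_eq_one) c l := by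
    simp only [wordPoly, wordTransform, LinearMap.sum_apply, LinearMap.comp_apply,
      LinearMap.proj_apply, Polynomial.map_sum, map_monomial, eval_finsetSum, eval_monomial]
    refine Finset.sum_congr rfl fun i _ => ?_
    rw [← nsmul_eq_mul, AddChar.map_nsmul_eq_pow, AddChar.zmodChar_apply]
  rw [this]

end Membership

/-! ### Orthogonality for extended words. -/

section Hull

variable {F K : Type*} [Field F] [Field K] [Algebra F K] {p : ℕ}

theorem mem_extendedCode_iff {n : ℕ} {C : Submodule F (Fin n → F)} {x : Option (Fin n) → F} :
    x ∈ extendedCode C ↔ (fun i => x (some i)) ∈ C ∧ x none = -∑ i, x (some i) := by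
  rw [← add_eq_zero_iff_eq_neg, ← Fintype.sum_option]
  rfl

theorem hermInner_option (r : ℕ) {n : ℕ} (x y : Option (Fin n) → F) :
    hermInner r x y =
      x none * y none ^ r + hermInner r (fun i => x (some i)) (fun i => y (some i)) := by
  simp [hermInner, Fintype.sum_option]

theorem hermInner_one_left (r : ℕ) [Fact r.Prime] [CharP F r] {ι : Type*} [Fintype ι] (y : ι → F) :
    hermInner r (fun _ => 1) y = (∑ i, y i) ^ r := by
  simp [hermInner, sum_pow_char]

variable [Fact p.Prime]

theorem wordTransform_const {ψ : AddChar (ZMod p) K} (hψ : ψ.IsPrimitive) (c : F) {k : ZMod p} (hk : k ≠ 0) :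
    wordTransform ψ (fun _ : Fin p => c) k = 0 := by
  rw [wordTransform, ← Finset.mul_sum, hψ.sum_fin_mul, if_neg hk, mul_zero]

/-- On extended words only the frequency `0` is changed in the Fourier expression of the Hermitian
inner product. -/
theorem hermInner_extended_eq_zero (r : ℕ) [Fact r.Prime] [CharP F r] [CharP K r]
    (hr : (r : ZMod p) ≠ 0) (hp : (p : K) ≠ 0) {ψ : AddChar (ZMod p) K} (hψ : ψ.IsPrimitive)
    {x y : Option (Fin p) → F} (hx : x none = -∑ i, x (some i)) (hy : y none = -∑ i, y (some i))
    (h : ∀ k ≠ 0, wordTransform ψ (fun i => x (some i)) (-r * k) *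
      wordTransform ψ (fun i => y (some i)) k ^ r = 0)
    (h0 : (p + 1 : F) * (x none * y none ^ r) = 0) : hermInner r x y = 0 := by
  apply (algebraMap F K).injective
  apply mul_left_cancel₀ hp
  have h1 := mul_hermInner_eq_sum_wordTransform r hr hψ (fun i => x (some i)) (fun i => y (some i))
  rw [Finset.sum_eq_single 0 (fun k _ hk => h k hk) (by simp), mul_zero, wordTransform_zero_right,
    wordTransform_zero_right, ← neg_eq_iff_eq_neg.2 hx, ← neg_eq_iff_eq_neg.2 hy, ← map_pow,
    neg_pow (y none), neg_one_pow_char F r] at h1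
  rw [hermInner_option, map_add, mul_add, h1, ← map_natCast (algebraMap F K), ← map_mul, ← map_mul,
    ← map_add, map_zero, mul_zero, ← map_zero (algebraMap F K), ← h0]
  congr 1
  ring

variable [Finite F]

/-- A word orthogonal to the zero-sum words of a quadratic residue code has no frequencies `k` with
`-r * k` a non-residue. -/
theorem wordTransform_eq_zero_of_forall_hermInner (r : ℕ) [Fact r.Prime] [CharP K r]
    (hr : (r : ZMod p) ≠ 0) (hp : (p : K) ≠ 0)
    (hF : Nat.card F = r ^ 2) (hq : (Nat.card F : ZMod p) ∈ quadResidues p) {α : K}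
    (hα : IsPrimitiveRoot α p) {y : Fin p → F}
    (hy : ∀ x ∈ qrCode F p α, ∑ i, x i = 0 → hermInner r x y = 0) {k : ZMod p}
    (hk : -(r : ZMod p) * k ∈ quadNonresidues p) :
    wordTransform (AddChar.zmodChar p hα.pow_eq_one) y k = 0 := by
  have hψ := AddChar.zmodChar_primitive_of_primitive_root p hα
  have hT : ∀ k, (r : ZMod p) ^ 2 * k ∈ quadNonresidues p ↔ k ∈ quadNonresidues p := fun k => by
    rw [mem_quadNonresidues_iff, mem_quadNonresidues_iff, map_mul, quadraticChar_sq_one' hr, one_mul]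
  choose e he using exists_wordTransform_eq r hF hr hψ (quadNonresidues p) hT
  refine wordTransform_eq_zero_of_hermInner r hr hp hψ _ e he y (fun s => hy _ ?_ ?_) hk
  · rw [mem_qrCode_iff hq hα]
    intro l hl
    rw [he, if_neg fun h => notMem_quadResidues h hl]
  · apply (algebraMap F K).injective
    rw [← wordTransform_zero_right (AddChar.zmodChar p hα.pow_eq_one), he,
      if_neg fun h => ne_zero_of_mem_quadNonresidues h rfl, map_zero]

theorem const_mem_qrCode (hq : (Nat.card F : ZMod p) ∈ quadResidues p) {α : K}
    (hα : IsPrimitiveRoot α p) (c : F) : (fun _ => c) ∈ qrCode F p α := by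
  rw [mem_qrCode_iff hq hα]
  intro l hl
  refine wordTransform_const (AddChar.zmodChar_primitive_of_primitive_root p hα) c ?_
  rintro rfl
  exact zero_notMem_quadResidues hl

theorem wordTransform_eq_zero_of_mem_hermitianDual_extendedCode (r : ℕ) [Fact r.Prime]
    [CharP F r] [CharP K r] (hr : (r : ZMod p) ≠ 0)
    (hp : (p : K) ≠ 0) (hF : Nat.card F = r ^ 2) (hq : (Nat.card F : ZMod p) ∈ quadResidues p)
    {α : K} (hα : IsPrimitiveRoot α p) {y : Option (Fin p) → F}
    (hy : y ∈ hermitianDual r (extendedCode (qrCode F p α))) {k : ZMod p}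
    (hk : -(r : ZMod p) * k ∈ quadNonresidues p) :
    wordTransform (AddChar.zmodChar p hα.pow_eq_one) (fun i => y (some i)) k = 0 := by
  refine wordTransform_eq_zero_of_forall_hermInner r hr hp hF hq hα (fun x hx hx0 => ?_) hk
  -- A zero-sum codeword extends by 0, so the pairing does not see `y none`.
  have h := hy (fun o => o.elim 0 x) (mem_extendedCode_iff.2 ⟨hx, by simp [hx0]⟩)
  rw [hermInner_option] at h
  simpa using h

theorem add_one_mul_none_eq_zero (r : ℕ) [Fact r.Prime] [CharP F r]
    (hq : (Nat.card F : ZMod p) ∈ quadResidues p)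
    {α : K} (hα : IsPrimitiveRoot α p) {y : Option (Fin p) → F}
    (hy : y ∈ extendedCode (qrCode F p α) ⊓ hermitianDual r (extendedCode (qrCode F p α))) :
    (p + 1 : F) * y none = 0 := by
  have h1 := (mem_extendedCode_iff.1 hy.1).2
  -- Test against the extension of the all-one codeword, whose entry at ∞ is -p.
  have h := hy.2 (fun o => o.elim (-(p : F)) fun _ => 1)
    (mem_extendedCode_iff.2 ⟨const_mem_qrCode hq hα 1, by simp⟩)
  rw [hermInner_option] at h
  simp only [Option.elim] at h
  rw [hermInner_one_left, ← neg_eq_iff_eq_neg.2 h1, neg_pow (y none), neg_one_pow_char F r] at h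
  have h2 : (p + 1 : F) * y none ^ r = 0 := by linear_combination -h
  rcases mul_eq_zero.1 h2 with h3 | h3
  · rw [h3, zero_mul]
  · rw [eq_zero_of_pow_eq_zero h3, mul_zero]

end Hull

/-! ### The four cases. -/

theorem mainTheorem4 {F K : Type*} [Field F] [Field K] [Algebra F K]
    (p r : ℕ) [Fact p.Prime] [Fact r.Prime] [CharP F r]
    (hp2 : p ≠ 2) (hpr : p ≠ r) (hF : Nat.card F = r ^ 2)
    (α : K) (hα : IsPrimitiveRoot α p) :
    ((-(r : ZMod p) ∈ quadResidues p ∧ ¬ (p : ℤ) ≡ -1 [ZMOD r]) →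
      extendedCode (qrCode F p α) ⊓ hermitianDual r (extendedCode (qrCode F p α)) = ⊥) ∧
    ((-(r : ZMod p) ∈ quadResidues p ∧ (p : ℤ) ≡ -1 [ZMOD r]) →
      extendedCode (qrCode F p α) ⊓ hermitianDual r (extendedCode (qrCode F p α)) =
        Submodule.span F {fun _ => (1 : F)}) ∧
    ((-(r : ZMod p) ∈ quadNonresidues p ∧ ¬ (p : ℤ) ≡ -1 [ZMOD r]) →
      extendedCode (qrCode F p α) ⊓ hermitianDual r (extendedCode (qrCode F p α)) =
        extendedCode (hermitianDual r (qrCode F p α))) ∧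
    ((-(r : ZMod p) ∈ quadNonresidues p ∧ (p : ℤ) ≡ -1 [ZMOD r]) →
      extendedCode (qrCode F p α) ⊓ hermitianDual r (extendedCode (qrCode F p α)) =
        extendedCode (qrCode F p α) ∧
      IsHermitianSelfDual r (extendedCode (qrCode F p α))) := by
  have hrp : r.Prime := Fact.out
  have hpp : p.Prime := Fact.out
  have : CharP K r := charP_of_injective_algebraMap (algebraMap F K).injective r
  have : Finite F := Nat.finite_of_card_ne_zero (by rw [hF]; exact pow_ne_zero 2 hrp.ne_zero)
  have hr : (r : ZMod p) ≠ 0 := by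
    rw [Ne, ZMod.natCast_eq_zero_iff]
    exact fun h => hpr ((Nat.prime_dvd_prime_iff_eq hpp hrp).1 h)
  have hp : (p : K) ≠ 0 := by
    rw [Ne, CharP.cast_eq_zero_iff K r]
    exact fun h => hpr ((Nat.prime_dvd_prime_iff_eq hrp hpp).1 h).symm
  have hq : (Nat.card F : ZMod p) ∈ quadResidues p := by
    rw [hF, mem_quadResidues_iff, Nat.cast_pow, quadraticChar_sq_one' hr]
  have hψ := AddChar.zmodChar_primitive_of_primitive_root p hα
  have hmod : (p : ℤ) ≡ -1 [ZMOD r] ↔ (p + 1 : F) = 0 := by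
    rw [Int.modEq_comm, Int.modEq_iff_dvd, ← CharP.intCast_eq_zero_iff F r]
    simp
  set ψ := AddChar.zmodChar p hα.pow_eq_one
  rw [hmod]
  have hval {k : ZMod p} (hk : k ≠ 0) (hnr : -(r : ZMod p) ∈ quadResidues p) :
      -(r : ZMod p) * k ∈ quadNonresidues p ∨ k ∈ quadResidues p := by
    refine (mem_quadResidues_or_mem_quadNonresidues hk).symm.imp_left fun h => ?_
    rw [mem_quadNonresidues_iff] at h ⊢
    rw [map_mul, mem_quadResidues_iff.1 hnr, h, one_mul]
  have hvalN {k : ZMod p} (hnr : -(r : ZMod p) ∈ quadNonresidues p) :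
      (-(r : ZMod p) * k ∈ quadNonresidues p ↔ k ∈ quadResidues p) ∧
      (-(r : ZMod p) * k ∈ quadResidues p ↔ k ∈ quadNonresidues p) := by
    simp only [mem_quadNonresidues_iff, mem_quadResidues_iff, map_mul,
      mem_quadNonresidues_iff.1 hnr]
    constructor <;> constructor <;> intro h <;> linarith
  -- In the first two cases the hull consists of constant words.
  have hconst (hnr : -(r : ZMod p) ∈ quadResidues p) (y : Option (Fin p) → F)
      (hy : y ∈ extendedCode (qrCode F p α) ⊓ hermitianDual r (extendedCode (qrCode F p α))) :
      ∀ k ≠ 0, wordTransform ψ (fun i => y (some i)) k = 0 := by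
    intro k hk
    rcases hval hk hnr with h | h
    · exact wordTransform_eq_zero_of_mem_hermitianDual_extendedCode r hr hp hF hq hα hy.2 h
    · exact (mem_qrCode_iff hq hα _).1 (mem_extendedCode_iff.1 hy.1).1 k h
  -- In the last two cases only the frequency `0` contributes to the inner product.
  have horth (hnr : -(r : ZMod p) ∈ quadNonresidues p) {x y : Option (Fin p) → F}
      (hx : x ∈ extendedCode (qrCode F p α)) (hy : y ∈ extendedCode (qrCode F p α))
      (h0 : (p + 1 : F) * (x none * y none ^ r) = 0) : hermInner r x y = 0 := by
    rw [mem_extendedCode_iff] at hx hy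
    refine hermInner_extended_eq_zero r hr hp hψ hx.2 hy.2 (fun k hk => ?_) h0
    rcases mem_quadResidues_or_mem_quadNonresidues hk with h | h
    · rw [(mem_qrCode_iff hq hα _).1 hy.1 k h, zero_pow hrp.ne_zero, mul_zero]
    · rw [(mem_qrCode_iff hq hα _).1 hx.1 _ ((hvalN hnr).2.2 h), zero_mul]
  refine ⟨?_, ?_, ?_, ?_⟩
  · rintro ⟨hnr, hne⟩
    rw [eq_bot_iff]
    intro y hy
    have hnone := (mul_eq_zero.1 (add_one_mul_none_eq_zero r hq hα hy)).resolve_left hne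
    have hsum := (mem_extendedCode_iff.1 hy.1).2
    rw [hnone, zero_eq_neg] at hsum
    have h : (fun i => y (some i)) = 0 := by
      refine wordTransform_injective hp hψ fun k => ?_
      have h0 : wordTransform ψ (0 : Fin p → F) k = 0 := by simp [wordTransform]
      rw [h0]
      by_cases hk : k = 0
      · rw [hk, wordTransform_zero_right, hsum, map_zero]
      · exact hconst hnr y hy k hk
    rw [Submodule.mem_bot]
    funext o
    cases o with
    | none => exact hnone
    | some i => exact congrFun h i
  · rintro ⟨hnr, h1⟩
    have hpF : (p : F) = -1 := eq_neg_of_add_eq_zero_left h1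
    apply le_antisymm
    · intro y hy
      have hsum := (mem_extendedCode_iff.1 hy.1).2
      -- At frequency 0 both sides agree because p = -1 in `F`.
      have h : (fun i => y (some i)) = fun _ => y none := by
        refine wordTransform_injective hp hψ fun k => ?_
        by_cases hk : k = 0
        · rw [hk, wordTransform_zero_right, wordTransform_zero_right, Finset.sum_const,
            Finset.card_univ, Fintype.card_fin, nsmul_eq_mul, hpF, hsum]
          simp
        · rw [hconst hnr y hy k hk, wordTransform_const hψ _ hk]
      rw [Submodule.mem_span_singleton]
      refine ⟨y none, funext fun o => ?_⟩
      cases o with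
      | none => simp
      | some i => simpa using (congrFun h i).symm
    · rw [Submodule.span_singleton_le_iff_mem]
      refine ⟨mem_extendedCode_iff.2 ⟨const_mem_qrCode hq hα 1, by simp [hpF]⟩, fun x hx => ?_⟩
      have hsum : ∑ o, x o = 0 := hx.2
      simpa [hermInner] using hsum
  · rintro ⟨hnr, hne⟩
    apply le_antisymm
    · intro y hy
      have hnone := (mul_eq_zero.1 (add_one_mul_none_eq_zero r hq hα hy)).resolve_left hne
      have hsum := (mem_extendedCode_iff.1 hy.1).2
      refine mem_extendedCode_iff.2 ⟨fun x hx => ?_, hsum⟩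
      have h : (fun o : Option (Fin p) => o.elim (-∑ i, x i) x) ∈ extendedCode (qrCode F p α) :=
        mem_extendedCode_iff.2 ⟨hx, rfl⟩
      have h2 := hy.2 _ h
      rw [hermInner_option, hnone, zero_pow hrp.ne_zero, mul_zero, zero_add] at h2
      exact h2
    · intro y hy
      obtain ⟨hd, hsum⟩ := mem_extendedCode_iff.1 hy
      -- Orthogonality to the all-one codeword makes `y none` vanish, so frequency 0 contributes
      -- nothing.
      have h0 : ∑ i, y (some i) = 0 := by
        have h := hd _ (const_mem_qrCode hq hα 1)
        rw [hermInner_one_left] at h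
        exact eq_zero_of_pow_eq_zero h
      have hmem : y ∈ extendedCode (qrCode F p α) := by
        refine mem_extendedCode_iff.2 ⟨(mem_qrCode_iff hq hα _).2 fun l hl => ?_, hsum⟩
        exact wordTransform_eq_zero_of_forall_hermInner r hr hp hF hq hα
          (fun x hx _ => hd x hx) ((hvalN hnr).1.2 hl)
      refine ⟨hmem, fun x hx => horth hnr hx hmem ?_⟩
      rw [hsum, h0, neg_zero, zero_pow hrp.ne_zero, mul_zero, mul_zero]
  · rintro ⟨hnr, h1⟩
    have hle : extendedCode (qrCode F p α) ≤ hermitianDual r (extendedCode (qrCode F p α)) :=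
      fun y hy x hx => horth hnr hx hy (by rw [h1, zero_mul])
    refine ⟨inf_eq_left.2 hle, le_antisymm hle fun y hy => ?_⟩
    refine mem_extendedCode_iff.2 ⟨(mem_qrCode_iff hq hα _).2 fun l hl => ?_, ?_⟩
    · exact wordTransform_eq_zero_of_mem_hermitianDual_extendedCode r hr hp hF hq hα hy
        ((hvalN hnr).1.2 hl)
    -- Since p = -1 in `F`, the all-one word is in the extended code; pairing with it gives the
    -- zero-sum condition.
    · have h := hy (fun _ => 1) (mem_extendedCode_iff.2
        ⟨const_mem_qrCode hq hα 1, by simp [eq_neg_of_add_eq_zero_left h1]⟩)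
      rw [hermInner_one_left] at h
      rw [← add_eq_zero_iff_eq_neg, ← Fintype.sum_option]
      exact eq_zero_of_pow_eq_zero h
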